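/- Let $k$ be a field, treated as a discrete topological ring. A \emph{pseudocompact $k$-algebra} is a (unital, associative) topological $k$-algebra having a basis of neighbourhoods of $0$ consisting of two-sided ideals of finite codimension whose intersection is $0$, and complete with respect to this topology. A \emph{pseudocompact left module} over such an algebra $A$ is an inverse limit of discrete finite dimensional topological left $A$-modules; equivalently, a complete Hausdorff topological left $A$-module in which the open submodules of finite codimension form a basis of neighbourhoods of $0$. It is \emph{simple} if it is non-zero and its only closed submodules are $0$ and itself. ``Maximal closed'' (left, right, two-sided) ideal means maximal among the proper closed (left, right, two-sided) ideals, and an empty intersection of ideals of $A$ is $A$. An element $a\in A$ is a \emph{non-generator} if, whenever $X\subseteq A$ and the left ideal generated by $X\cup\{a\}$ is $A$, the left ideal generated by $X$ is already $A$; it is a \emph{topological non-generator} if the same holds with ``closed left ideal generated by'' in place of ``left ideal generated by''. For a closed two-sided ideal $I$ put $I^1=I$ and, for $n\geq 2$, let $I^n$ be the closure of the product $I^{n-1}I$; $I$ is \emph{pronilpotent} if $\bigcap_{n\geq 1} I^n=0$. \textbf{Proposition.} Let $A$ be a pseudocompact $k$-algebra. The following subsets of $A$ exist and are equal: \begin{enumerate}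 \item[(1)] the intersection of the maximal closed left ideals of $A$; \item[(2)] the intersection of the maximal closed right ideals of $A$; \item[(3)] the intersection of the maximal closed two-sided ideals of $A$; \item[(4)] the intersection of the (not necessarily closed) maximal left ideals of $A$; \item[(5)] $\{x\in A \mid 1-yx \text{ is left invertible for every } y\in A\}$; \item[(6)] $\{x\in A \mid 1-yxz \text{ is invertible for all } y,z\in A\}$; \item[(7)] the set of all non-generators of $A$; \item[(8)] the set of all topological non-generators of $A$; \item[(9)] the intersection of the annihilators of the simple pseudocompact left $A$-modules; \item[(10)] the smallest closed left submodule $V$ of $A$ such that $A/V$ is isomorphic, as a topological left $A$-module, to a direct product of simple pseudocompact left $A$-modules; \item[(11)] the largest closed pronilpotent two-sided ideal of $A$. \end{enumerate} -/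

import Mathlib

open Topology

universe u v

/-- A pseudocompact algebra over the (discrete) field `k`: a complete Hausdorff topological
algebra in which the open two-sided ideals of finite codimension form a basis of neighbourhoods
of `0`.  (For a basis of neighbourhoods of `0` consisting of ideals, being Hausdorff means exactly
that their intersection is `0`.  As `k` is discrete, continuity of the scalar multiplication
`k × A → A` is a consequence of the continuity of the multiplication of `A`.)  The uniform
structure is the one of the additive topological group `A`. -/
structure IsPseudocompactAlgebra (k : Type u) (A : Type v) [Field k] [Ring A] [Algebra k A]
    [UniformSpace A] [IsUniformAddGroup A] [IsTopologicalRing A] : Prop where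
  t2 : T2Space A
  complete : CompleteSpace A
  hasBasis : (𝓝 (0 : A)).HasBasis
    (fun I : Ideal A => IsOpen (I : Set A) ∧ I.IsTwoSided ∧ FiniteDimensional k (A ⧸ I))
    (fun I => (I : Set A))

/-- A pseudocompact left `A`-module, i.e. an inverse limit of discrete finite dimensional
`A`-modules, described intrinsically: a complete Hausdorff topological `A`-module in which the open
submodules of finite codimension form a basis of neighbourhoods of `0`.  Its `k`-vector space
structure is the one induced by `k → A` (field `tower`). -/
structure IsPseudocompactModule (k : Type u) (A : Type v) [Field k] [Ring A] [Algebra k A]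
    [UniformSpace A] (S : Type v) [AddCommGroup S] [Module k S] [Module A S]
    [UniformSpace S] : Prop where
  [tower : IsScalarTower k A S]
  uniformAddGroup : IsUniformAddGroup S
  continuousSMul : ContinuousSMul A S
  t2 : T2Space S
  complete : CompleteSpace S
  hasBasis : (𝓝 (0 : S)).HasBasis
    (fun N : Submodule A S => IsOpen (N : Set S) ∧ FiniteDimensional k (S ⧸ N))
    (fun N => (N : Set S))

/-- A simple pseudocompact module: a nonzero pseudocompact module whose only closed submodules
are `0` and itself. -/
structure IsSimplePseudocompactModule (k : Type u) (A : Type v) [Field k] [Ring A] [Algebra k A]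
    [UniformSpace A] (S : Type v) [AddCommGroup S] [Module k S] [Module A S]
    [UniformSpace S] : Prop extends IsPseudocompactModule k A S where
  nontrivial : Nontrivial S
  eq_bot_or_eq_top : ∀ N : Submodule A S, IsClosed (N : Set S) → N = ⊥ ∨ N = ⊤

/-- The quotient `A / V`, with the quotient topology, is isomorphic as a topological left
`A`-module to a direct product (with the product topology) of simple pseudocompact modules. -/
def QuotientIsProductOfSimples (k : Type u) {A : Type v} [Field k] [Ring A] [Algebra k A]
    [UniformSpace A] (V : Submodule A A) : Prop :=
  ∃ (ι : Type v) (S : ι → Type v) (_ : ∀ i, AddCommGroup (S i)) (_ : ∀ i, Module k (S i))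
    (_ : ∀ i, Module A (S i)) (_ : ∀ i, UniformSpace (S i)),
    (∀ i, IsSimplePseudocompactModule k A (S i)) ∧ Nonempty ((A ⧸ V) ≃L[A] (∀ i, S i))

section Ideals

variable {A : Type v} [Ring A] [TopologicalSpace A]

/-- A maximal closed left ideal: maximal among the proper closed left ideals. -/
def IsMaximalClosedLeftIdeal (M : Ideal A) : Prop :=
  Maximal (fun I : Ideal A => IsClosed (I : Set A) ∧ I ≠ ⊤) M

/-- A maximal closed right ideal (right ideals are submodules of `A` over the opposite ring). -/
def IsMaximalClosedRightIdeal (M : Submodule Aᵐᵒᵖ A) : Prop :=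
  Maximal (fun I : Submodule Aᵐᵒᵖ A => IsClosed (I : Set A) ∧ I ≠ ⊤) M

/-- A maximal closed two-sided ideal: maximal among the proper closed two-sided ideals. -/
def IsMaximalClosedTwoSidedIdeal (M : Ideal A) : Prop :=
  Maximal (fun I : Ideal A => I.IsTwoSided ∧ IsClosed (I : Set A) ∧ I ≠ ⊤) M

variable (A) in
/-- The topological Jacobson radical: the intersection of the maximal closed left ideals (the
whole of `A` if there are none). -/
def topologicalJacobsonRadical : Ideal A :=
  sInf {M : Ideal A | IsMaximalClosedLeftIdeal M}

/-- `a` is a non-generator: whenever `X ∪ {a}` generates `A` as a left ideal, so does `X`. -/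
def IsNonGenerator (a : A) : Prop :=
  ∀ X : Set A, Ideal.span (X ∪ {a}) = ⊤ → Ideal.span X = ⊤

variable [IsTopologicalRing A]

/-- `a` is a topological non-generator: whenever the closed left ideal generated by `X ∪ {a}`
is `A`, so is the closed left ideal generated by `X`. -/
def IsTopologicalNonGenerator (a : A) : Prop :=
  ∀ X : Set A, (Ideal.span (X ∪ {a})).closure = ⊤ → (Ideal.span X).closure = ⊤

/-- The powers of a closed ideal in the topological sense: `I¹ = I` and `Iⁿ` is the closure of the
product `Iⁿ⁻¹ I` for `n ≥ 2`.  (`I⁰ = A`.) -/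
def closedPow (I : Ideal A) : ℕ → Ideal A
  | 0 => ⊤
  | 1 => I
  | n + 2 => (closedPow I (n + 1) * I).closure

/-- The ideal `I` is pronilpotent: the intersection of its closed powers is `0`. -/
def IsPronilpotent (I : Ideal A) : Prop :=
  ⨅ n : ℕ, closedPow I n = ⊥

end Ideals

/-! Everything rests on linear compactness (`exists_forall_sub_mem_of_compatible`): since the basic
ideals have Artinian quotients and `A` is complete, compatible directed systems of congruences
modulo closed left ideals are solvable. Inverses modulo the basic ideals therefore glue, and an
element that is one-sided invertible modulo every basic ideal is a unit (`isUnit_of_forall_left`).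

A maximal closed left ideal is the same as a maximal left ideal containing a basic ideal. If `x`
lies in all of these, then `1 + y * x` is left invertible modulo each basic ideal, hence a unit; so
the topological radical is the abstract `Ring.jacobson A`, with which all other sets are compared.
The right-handed version follows because units are left-right symmetric. For two-sided ideals, the
annihilator of a simple quotient `A ⧸ N` is maximal, its quotient ring being semisimple with a
faithful simple module.

Modulo a basic ideal the radical is nilpotent, so the radical is pronilpotent; conversely linear
compactness forces some closed power of a closed pronilpotent ideal into any given basic ideal, and
geometric series invert `1 - y * x`. For the product decomposition, an independent subfamily of the
maximal closed left ideals with the same intersection satisfies a Chinese remainder theorem, first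
for finite subfamilies and then, by linear compactness, for the whole family. -/

/-! ### Linear compactness -/

open Filter in
/-- **Linear compactness.** In a complete linearly topologized module whose open submodules have
Artinian quotients, a directed compatible family of cosets of closed submodules has a common
point. -/
theorem exists_forall_sub_mem_of_compatible {R M ι : Type*} [Ring R] [AddCommGroup M] [Module R M]
    [UniformSpace M] [IsUniformAddGroup M] [CompleteSpace M]
    {p : Submodule R M → Prop} (hp : ∀ N, p N → IsArtinian R (M ⧸ N))
    (hB : (𝓝 (0 : M)).HasBasis p (fun N => (N : Set M)))
    [Preorder ι] [IsDirectedOrder ι] [Nonempty ι] (N : ι → Submodule R M) (hN : Antitone N)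
    (hcl : ∀ i, IsClosed (N i : Set M)) (c : ι → M) (hc : ∀ i j, i ≤ j → c j - c i ∈ N i) :
    ∃ a, ∀ i, a - c i ∈ N i := by
  let coset (x : M) (P : Submodule R M) : Set M := {y | y - x ∈ P}
  have coset_closed (x : M) (P : Submodule R M) (hP : IsClosed (P : Set M)) :
      IsClosed (coset x P) := hP.preimage (continuous_id.sub continuous_const)
  have pclosed (P : Submodule R M) (hP : p P) : IsClosed (P : Set M) :=
    P.toAddSubgroup.isClosed_of_isOpen
      (P.toAddSubgroup.isOpen_of_mem_nhds (g := 0) (hB.mem_of_mem hP))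
  -- `S` consists of the proper filters with a base of closed cosets. The dual order makes Zorn
  -- produce a finest such filter, a linear substitute for an ultrafilter.
  let S : Set (Filter M)ᵒᵈ := {G | NeBot (OrderDual.ofDual G) ∧ ∀ s ∈ OrderDual.ofDual G,
    ∃ P : Submodule R M, ∃ x, IsClosed (P : Set M) ∧ coset x P ∈ OrderDual.ofDual G ∧
      coset x P ⊆ s}
  let G₀ : Filter M := ⨅ i, 𝓟 (coset (c i) (N i))
  have hdir : Directed (· ≥ ·) fun i => 𝓟 (coset (c i) (N i)) := by
    have mono : ∀ i j, i ≤ j → coset (c j) (N j) ⊆ coset (c i) (N i) := fun i j h y hy => by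
      have := (N i).add_mem (hN h hy) (hc i j h)
      simpa [coset] using this
    intro i j
    obtain ⟨l, hi, hj⟩ := exists_ge_ge i j
    exact ⟨l, principal_mono.2 (mono _ _ hi), principal_mono.2 (mono _ _ hj)⟩
  have hG₀ : OrderDual.toDual G₀ ∈ S := by
    refine ⟨iInf_neBot_of_directed' hdir fun i => ?_, fun s hs => ?_⟩
    · exact principal_neBot_iff.2 ⟨c i, by simp [coset]⟩
    · obtain ⟨i, hi⟩ := (mem_iInf_of_directed hdir s).1 hs
      exact ⟨N i, c i, hcl i, mem_iInf_of_mem i (mem_principal_self _), hi⟩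
  obtain ⟨G, hle, hG⟩ := zorn_le_nonempty₀ S (by
    intro C hCS hC G hG
    have hne : (OrderDual.ofDual '' C).Nonempty := ⟨_, G, hG, rfl⟩
    have hd : DirectedOn (· ≥ ·) (OrderDual.ofDual '' C) := by
      rintro _ ⟨a, ha, rfl⟩ _ ⟨b, hb, rfl⟩
      rcases hC.total ha hb with h | h
      · exact ⟨_, ⟨b, hb, rfl⟩, h, le_rfl⟩
      · exact ⟨_, ⟨a, ha, rfl⟩, le_rfl, h⟩
    refine ⟨OrderDual.toDual (sInf (OrderDual.ofDual '' C)), ⟨?_, fun s hs => ?_⟩,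
      fun z hz => sInf_le (a := OrderDual.ofDual z) ⟨z, hz, rfl⟩⟩
    · refine sInf_neBot_of_directed' hne hd ?_
      rintro ⟨a, ha, h⟩
      exact (hCS ha).1.ne h
    · rw [OrderDual.ofDual_toDual, sInf_eq_iInf] at hs
      obtain ⟨_, ⟨a, ha, rfl⟩, h⟩ := (mem_biInf_of_directed hd hne).1 hs
      obtain ⟨P, x, h1, h2, h3⟩ := (hCS ha).2 s h
      exact ⟨P, x, h1, (sInf_le (a := OrderDual.ofDual a) ⟨a, ha, rfl⟩ :
        sInf (OrderDual.ofDual '' C) ≤ _) h2, h3⟩) _ hG₀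
  obtain ⟨G, rfl⟩ := OrderDual.toDual.surjective G
  have hle : G ≤ G₀ := hle
  obtain ⟨hGne, hGlin⟩ : NeBot G ∧ ∀ s ∈ G, ∃ P : Submodule R M, ∃ x, IsClosed (P : Set M) ∧
    coset x P ∈ G ∧ coset x P ⊆ s := hG.prop
  have key : ∀ I, p I → ∃ x, coset x I ∈ G := by
    intro I hI
    have := hp I hI
    -- The Artinian quotient supplies a coset in `G` whose direction `P` has minimal image modulo
    -- `I`. Intersecting with further members of `G` cannot shrink that image, so `x + I` meets
    -- every member.
    obtain ⟨_, ⟨P, x, hPx, rfl⟩, hmin⟩ := wellFounded_lt.has_min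
      {Q : Submodule R (M ⧸ I) | ∃ P : Submodule R M, ∃ x, coset x P ∈ G ∧ P.map I.mkQ = Q}
      (by
        obtain ⟨P, x, -, h, -⟩ := hGlin _ univ_mem
        exact ⟨_, P, x, h, rfl⟩)
    refine ⟨x, ?_⟩
    have meet : ∀ s ∈ G, (coset x I ∩ s).Nonempty := by
      intro s hs
      obtain ⟨P', x', -, h1, h2⟩ := hGlin s hs
      obtain ⟨z, hz, hz'⟩ := hGne.nonempty_of_mem (inter_mem hPx h1)
      have hin : coset z (P ⊓ P') ∈ G := by
        filter_upwards [hPx, h1] with y hy hy'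
        exact ⟨by simpa using P.sub_mem hy hz, by simpa using P'.sub_mem hy' hz'⟩
      have hlt := hmin _ ⟨P ⊓ P', z, hin, rfl⟩
      have heq : (P ⊓ P').map I.mkQ = P.map I.mkQ :=
        (Submodule.map_mono inf_le_left).eq_of_not_lt hlt
      have hxz : I.mkQ (x - z) ∈ (P ⊓ P').map I.mkQ := by
        rw [heq]
        exact Submodule.mem_map_of_mem (by simpa using P.neg_mem hz)
      obtain ⟨q, hq, hqe⟩ := hxz
      refine ⟨z + q, ?_, h2 ?_⟩
      · have : q - (x - z) ∈ I := (Submodule.Quotient.eq I).1 hqe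
        change z + q - x ∈ I
        convert this using 1; abel
      · have := P'.add_mem hz' hq.2
        change z + q - x' ∈ P'
        convert this using 1; abel
    have hmem : OrderDual.toDual (G ⊓ 𝓟 (coset x I)) ∈ S := by
      refine ⟨?_, fun s hs => ?_⟩
      · refine inf_principal_neBot_iff.2 fun U hU => ?_
        rw [Set.inter_comm]; exact meet U hU
      · obtain ⟨P', x', hcl', h1, h2⟩ := hGlin _ (mem_inf_principal.1 hs)
        obtain ⟨z, hz, hz'⟩ := meet _ h1
        refine ⟨P' ⊓ I, z, hcl'.inter (pclosed I hI), ?_, fun y hy => h2 ?_ ?_⟩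
        · refine mem_inf_principal.2 ?_
          filter_upwards [h1] with y hy hy'
          exact ⟨by simpa using P'.sub_mem hy hz', by simpa using I.sub_mem hy' hz⟩
        · have := P'.add_mem hy.1 hz'
          simpa [coset] using this
        · have := I.add_mem hy.2 hz
          simpa [coset] using this
    -- As `G` is finest, it already contains `x + I`.
    have hGle : G ≤ G ⊓ 𝓟 (coset x I) :=
      hG.le_of_ge hmem (show G ⊓ 𝓟 (coset x I) ≤ G from inf_le_left)
    exact le_principal_iff.1 (hGle.trans inf_le_right)
  have hcauchy : Cauchy G := by
    refine cauchy_iff.2 ⟨hGne, fun s hs => ?_⟩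
    rw [uniformity_eq_comap_nhds_zero] at hs
    obtain ⟨I, hI, hIs⟩ := (hB.comap _).mem_iff.1 hs
    obtain ⟨x, hx⟩ := key I hI
    refine ⟨_, hx, fun q hq => hIs ?_⟩
    have := I.sub_mem hq.2 hq.1
    simpa using this
  obtain ⟨a, ha⟩ := CompleteSpace.complete hcauchy
  refine ⟨a, fun i => ?_⟩
  have hmem : coset (c i) (N i) ∈ G := hle (mem_iInf_of_mem i (mem_principal_self _))
  change a ∈ coset (c i) (N i)
  exact (coset_closed _ _ (hcl i)).mem_of_tendsto (f := id) ha hmem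

/-! ### Closed and open submodules in a linear topology -/

/-- A point `x` outside `P` has a basic neighbourhood `x - N` missing `P`, so `x` is also outside `P
⊔ N`. This replaces a proper closed submodule by a proper open one. -/
theorem Submodule.exists_sup_ne_top_of_isClosed {R M : Type*} [Ring R] [AddCommGroup M]
    [Module R M] [TopologicalSpace M] [IsTopologicalAddGroup M]
    {p : Submodule R M → Prop} (hB : (𝓝 (0 : M)).HasBasis p (fun N => (N : Set M)))
    {P : Submodule R M} (hP : IsClosed (P : Set M)) (hne : P ≠ ⊤) : ∃ N, p N ∧ P ⊔ N ≠ ⊤ := by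
  obtain ⟨x, hx⟩ : ∃ x, x ∉ P := by
    by_contra! h
    exact hne (eq_top_iff.2 fun x _ => h x)
  have : {y | x - y ∈ (P : Set M)ᶜ} ∈ 𝓝 (0 : M) :=
    (hP.isOpen_compl.preimage (continuous_const.sub continuous_id)).mem_nhds (by simpa using hx)
  obtain ⟨N, hN, hsub⟩ := hB.mem_iff.1 this
  refine ⟨N, hN, fun h => ?_⟩
  obtain ⟨y, hy, z, hz, hyz⟩ := Submodule.mem_sup.1 (h ▸ mem_top : x ∈ P ⊔ N)
  exact hsub hz (by simpa [← hyz] using hy)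

theorem Submodule.isOpen_of_ge {R M : Type*} [Ring R] [AddCommGroup M]
    [Module R M] [TopologicalSpace M] [IsTopologicalAddGroup M] {N P : Submodule R M}
    (hN : IsOpen (N : Set M)) (h : N ≤ P) : IsOpen (P : Set M) :=
  AddSubgroup.isOpen_mono (H₁ := N.toAddSubgroup) (H₂ := P.toAddSubgroup) h hN

theorem Submodule.isClosed_of_isOpen {R M : Type*} [Ring R] [AddCommGroup M]
    [Module R M] [TopologicalSpace M] [IsTopologicalAddGroup M] {N : Submodule R M}
    (hN : IsOpen (N : Set M)) : IsClosed (N : Set M) :=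
  N.toAddSubgroup.isClosed_of_isOpen hN

/-- A proper `P ⊔ N` with `N` basic is open, hence closed, so maximality absorbs `N` into `P`. Every
submodule above `N` is again closed, so maximality among closed submodules becomes plain maximality.
-/
theorem Submodule.maximal_isClosed_iff {R M : Type*} [Ring R] [AddCommGroup M]
    [Module R M] [TopologicalSpace M] [IsTopologicalAddGroup M]
    {p : Submodule R M → Prop} (hB : (𝓝 (0 : M)).HasBasis p (fun N => (N : Set M)))
    {P : Submodule R M} :
    Maximal (fun I : Submodule R M => IsClosed (I : Set M) ∧ I ≠ ⊤) P ↔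
      IsCoatom P ∧ ∃ N, p N ∧ N ≤ P := by
  have hop : ∀ N, p N → IsOpen (N : Set M) := fun N hN =>
    N.toAddSubgroup.isOpen_of_mem_nhds (g := 0) (hB.mem_of_mem hN)
  constructor
  · intro h
    obtain ⟨N, hN, hne⟩ := exists_sup_ne_top_of_isClosed hB h.prop.1 h.prop.2
    have hle : N ≤ P := le_sup_right.trans <|
      h.le_of_ge ⟨isClosed_of_isOpen (isOpen_of_ge (hop N hN) le_sup_right), hne⟩ le_sup_left
    refine ⟨⟨h.prop.2, fun Q hQ => ?_⟩, N, hN, hle⟩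
    by_contra hQt
    exact hQ.not_ge (h.le_of_ge
      ⟨isClosed_of_isOpen (isOpen_of_ge (hop N hN) (hle.trans hQ.le)), hQt⟩ hQ.le)
  · rintro ⟨hco, N, hN, hle⟩
    refine ⟨⟨isClosed_of_isOpen (isOpen_of_ge (hop N hN) hle), hco.1⟩, fun Q hQ h => ?_⟩
    exact (h.lt_or_eq.resolve_left fun hlt => hQ.2 (hco.2 _ hlt)).ge

/-! ### Basic ideals and algebraic preliminaries -/

section Cofinite

variable {k : Type u} {A : Type v} [Field k] [Ring A] [Algebra k A]

/-- The open two-sided ideals of finite codimension. -/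
def IsCofiniteOpenIdeal (k : Type u) {A : Type v} [Field k] [Ring A] [Algebra k A]
    [TopologicalSpace A] (I : Ideal A) : Prop :=
  IsOpen (I : Set A) ∧ I.IsTwoSided ∧ FiniteDimensional k (A ⧸ I)

theorem isArtinian_quotient_of_finiteDimensional (k : Type u) [Field k] [Algebra k A]
    (I : Ideal A) [FiniteDimensional k (A ⧸ I)] : IsArtinian A (A ⧸ I) :=
  isArtinian_of_tower k inferInstance

theorem isArtinianRing_quotient_of_finiteDimensional (k : Type u) [Field k] [Algebra k A]
    (I : Ideal A) [I.IsTwoSided] [FiniteDimensional k (A ⧸ I)] : IsArtinianRing (A ⧸ I) :=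
  isArtinian_of_tower k inferInstance

/-- Modulo a two-sided ideal of finite codimension, one-sided inverses are two-sided. -/
theorem mul_sub_one_mem_comm (k : Type u) [Field k] [Algebra k A] {I : Ideal A} [I.IsTwoSided]
    [FiniteDimensional k (A ⧸ I)] {a b : A} (h : a * b - 1 ∈ I) : b * a - 1 ∈ I := by
  have := isArtinianRing_quotient_of_finiteDimensional k I
  rw [← Ideal.Quotient.eq, map_mul, map_one] at h ⊢
  exact mul_eq_one_symm h

end Cofinite

section RightIdeal

variable {A : Type v} [Ring A]

/-- A two-sided ideal as a right ideal. -/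
def Ideal.toRightIdeal (I : Ideal A) (hI : I.IsTwoSided) : Submodule Aᵐᵒᵖ A where
  carrier := I
  zero_mem' := I.zero_mem
  add_mem' := I.add_mem
  smul_mem' := fun a _ hx => I.mul_mem_right a.unop hx

end RightIdeal

/-- The geometric series suggests the inverse `1 + b * (1 - a * b)⁻¹ * a`. -/
theorem IsUnit.one_sub_mul_comm {R : Type*} [Ring R] {a b : R} (h : IsUnit (1 - a * b)) :
    IsUnit (1 - b * a) := by
  obtain ⟨u, hu⟩ := h
  have h1 : a * b * ↑u⁻¹ = ↑u⁻¹ - 1 := by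
    have := u.mul_inv
    rw [hu, sub_mul, one_mul] at this
    rw [← this]; abel
  have h2 : ↑u⁻¹ * (a * b) = ↑u⁻¹ - 1 := by
    have := u.inv_mul
    rw [hu, mul_sub, mul_one] at this
    rw [← this]; abel
  refine isUnit_iff_exists.2 ⟨1 + b * ↑u⁻¹ * a, ?_, ?_⟩
  · calc (1 - b * a) * (1 + b * ↑u⁻¹ * a)
        = 1 - b * a + b * ↑u⁻¹ * a - b * (a * b * ↑u⁻¹) * a := by noncomm_ring
      _ = 1 := by rw [h1]; noncomm_ring
  · calc (1 + b * ↑u⁻¹ * a) * (1 - b * a)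
        = 1 - b * a + b * ↑u⁻¹ * a - b * (↑u⁻¹ * (a * b)) * a := by noncomm_ring
      _ = 1 := by rw [h2]; noncomm_ring

/-! ### Units, one-sided maximal ideals and non-generators -/

namespace IsPseudocompactAlgebra

variable {k : Type u} {A : Type v} [Field k] [Ring A] [Algebra k A]
    [UniformSpace A] [IsUniformAddGroup A] [IsTopologicalRing A]

theorem basis (hA : IsPseudocompactAlgebra k A) :
    (𝓝 (0 : A)).HasBasis (IsCofiniteOpenIdeal k) (fun I : Ideal A => (I : Set A)) :=
  hA.hasBasis

theorem basis_right (hA : IsPseudocompactAlgebra k A) :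
    (𝓝 (0 : A)).HasBasis
      (fun N : Submodule Aᵐᵒᵖ A => ∃ (I : Ideal A) (hI : IsCofiniteOpenIdeal k I),
        N = I.toRightIdeal hI.2.1)
      (fun N => (N : Set A)) := by
  refine ⟨fun s => hA.basis.mem_iff.trans ⟨?_, ?_⟩⟩
  · rintro ⟨I, hI, h⟩
    exact ⟨_, ⟨I, hI, rfl⟩, h⟩
  · rintro ⟨_, ⟨I, hI, rfl⟩, h⟩
    exact ⟨I, hI, h⟩

theorem exists_forall_sub_mem (hA : IsPseudocompactAlgebra k A) {ι : Type*}
    [Preorder ι] [IsDirectedOrder ι] [Nonempty ι] (N : ι → Ideal A) (hN : Antitone N)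
    (hcl : ∀ i, IsClosed (N i : Set A)) (c : ι → A) (hc : ∀ i j, i ≤ j → c j - c i ∈ N i) :
    ∃ a, ∀ i, a - c i ∈ N i := by
  have := hA.complete
  refine exists_forall_sub_mem_of_compatible (p := IsCofiniteOpenIdeal k) ?_ hA.basis N hN hcl c hc
  rintro I ⟨-, -, h⟩
  exact isArtinian_quotient_of_finiteDimensional k I

theorem eq_of_forall_sub_mem (hA : IsPseudocompactAlgebra k A) {a b : A}
    (h : ∀ I : Ideal A, IsCofiniteOpenIdeal k I → a - b ∈ I) : a = b := by
  have := hA.t2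
  by_contra hne
  obtain ⟨I, hI, hsub⟩ := hA.basis.mem_iff.1
    (isOpen_compl_singleton.mem_nhds (show (0 : A) ∈ ({a - b}ᶜ : Set A) from
      fun h => sub_ne_zero.2 hne (Set.mem_singleton_iff.1 h).symm))
  exact hsub (h I hI) rfl

/-- Left inverses modulo `I` are two-sided, hence unique modulo `I`, hence compatible as `I`
shrinks. Linear compactness glues them, and separatedness turns the congruences into equalities. -/
theorem isUnit_of_forall_left (hA : IsPseudocompactAlgebra k A) {x : A}
    (h : ∀ I : Ideal A, IsCofiniteOpenIdeal k I → ∃ b, b * x - 1 ∈ I) : IsUnit x := by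
  let ι := {I : Ideal A // IsCofiniteOpenIdeal k I}ᵒᵈ
  choose b hb using fun i : ι => h (OrderDual.ofDual i).1 (OrderDual.ofDual i).2
  have hb' : ∀ i : ι, x * b i - 1 ∈ (OrderDual.ofDual i).1 := fun i => by
    obtain ⟨-, h2, h3⟩ := (OrderDual.ofDual i).2
    exact mul_sub_one_mem_comm k (hb i)
  have : Nonempty ι := by
    obtain ⟨I, hI, -⟩ := hA.basis.mem_iff.1 Filter.univ_mem
    exact ⟨OrderDual.toDual ⟨I, hI⟩⟩
  have : IsDirectedOrder ι := ⟨fun i j => by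
    obtain ⟨I, hI, h⟩ := hA.basis.mem_iff.1 (Filter.inter_mem
      (hA.basis.mem_of_mem (OrderDual.ofDual i).2) (hA.basis.mem_of_mem (OrderDual.ofDual j).2))
    exact ⟨OrderDual.toDual ⟨I, hI⟩, fun x hx => (h hx).1, fun x hx => (h hx).2⟩⟩
  obtain ⟨a, ha⟩ := hA.exists_forall_sub_mem (ι := ι) (fun i => (OrderDual.ofDual i).1)
    (fun i j hij => hij)
    (fun i => Submodule.isClosed_of_isOpen (OrderDual.ofDual i).2.1) b (fun i j hij => by
      obtain ⟨-, h2, h3⟩ := (OrderDual.ofDual i).2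
      have e : b j - b i = (b j * x - 1) * b i - b j * (x * b i - 1) := by noncomm_ring
      rw [e]
      exact Ideal.sub_mem _ (Ideal.mul_mem_right _ _ (hij (hb j))) (Ideal.mul_mem_left _ _ (hb' i)))
  refine isUnit_iff_exists.2 ⟨a, hA.eq_of_forall_sub_mem fun I hI => ?_,
    hA.eq_of_forall_sub_mem fun I hI => ?_⟩
  · have h1 := Ideal.mul_mem_left I x (ha (OrderDual.toDual ⟨I, hI⟩))
    have := Ideal.add_mem I h1 (hb' (OrderDual.toDual ⟨I, hI⟩))
    convert this using 1; noncomm_ring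
  · have := hI.2.1
    have h1 := Ideal.mul_mem_right x I (ha (OrderDual.toDual ⟨I, hI⟩))
    have := Ideal.add_mem I h1 (hb (OrderDual.toDual ⟨I, hI⟩))
    convert this using 1; noncomm_ring

theorem isUnit_of_forall_right (hA : IsPseudocompactAlgebra k A) {x : A}
    (h : ∀ I : Ideal A, IsCofiniteOpenIdeal k I → ∃ b, x * b - 1 ∈ I) : IsUnit x :=
  hA.isUnit_of_forall_left fun I hI => by
    obtain ⟨b, hb⟩ := h I hI
    obtain ⟨-, h2, h3⟩ := hI
    exact ⟨b, mul_sub_one_mem_comm k hb⟩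

theorem isMaximalClosedLeftIdeal_iff (hA : IsPseudocompactAlgebra k A) {M : Ideal A} :
    IsMaximalClosedLeftIdeal M ↔ M.IsMaximal ∧ ∃ I, IsCofiniteOpenIdeal k I ∧ I ≤ M := by
  rw [Ideal.isMaximal_def]
  exact Submodule.maximal_isClosed_iff hA.basis

theorem isMaximalClosedRightIdeal_iff (hA : IsPseudocompactAlgebra k A) {M : Submodule Aᵐᵒᵖ A} :
    IsMaximalClosedRightIdeal M ↔
      IsCoatom M ∧ ∃ (I : Ideal A) (hI : IsCofiniteOpenIdeal k I), I.toRightIdeal hI.2.1 ≤ M :=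
  (Submodule.maximal_isClosed_iff hA.basis_right).trans <| and_congr_right fun _ =>
    ⟨fun ⟨_, ⟨I, hI, e⟩, h⟩ => ⟨I, hI, e ▸ h⟩, fun ⟨I, hI, h⟩ => ⟨_, ⟨I, hI, rfl⟩, h⟩⟩

/-- In a pseudocompact algebra the topological Jacobson radical is the Jacobson radical. -/
theorem topologicalJacobsonRadical_eq (hA : IsPseudocompactAlgebra k A) :
    topologicalJacobsonRadical A = Ring.jacobson A := by
  refine le_antisymm (fun x hx => ?_) (le_sInf fun M hM => ?_)
  · rw [← Ideal.jacobson_bot, Ideal.mem_jacobson_iff]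
    intro y
    have : IsUnit (1 + y * x) := hA.isUnit_of_forall_left fun I hI => by
      -- If this ideal is proper, a maximal left ideal above it contains `I`, so it is closed and
      -- contains `x` as well as `1 + y * x`.
      by_cases h : Ideal.span {1 + y * x} ⊔ I = ⊤
      · obtain ⟨b, c, hc, e⟩ := Ideal.mem_span_singleton_sup.1 (h ▸ Submodule.mem_top : (1 : A) ∈ _)
        refine ⟨b, ?_⟩
        have : b * (1 + y * x) - 1 = -c := by
          rw [← add_sub_cancel_right (b * (1 + y * x)) c, e]; abel
        exact this ▸ I.neg_mem hc
      · exfalso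
        obtain ⟨M, hM, hle⟩ := Ideal.exists_le_maximal _ h
        have hxM : x ∈ M := (sInf_le (hA.isMaximalClosedLeftIdeal_iff.2
          ⟨hM, I, hI, le_sup_right.trans hle⟩) : topologicalJacobsonRadical A ≤ M) hx
        have h1 : 1 + y * x ∈ M :=
          hle (Ideal.mem_sup_left (Ideal.mem_span_singleton_self _))
        exact hM.ne_top (M.eq_top_iff_one.2
          ((M.add_mem_iff_left (M.mul_mem_left y hxM)).1 h1))
    obtain ⟨b, hb⟩ := this.exists_left_inv
    refine ⟨b, ?_⟩
    rw [Ideal.mem_bot, mul_assoc, sub_eq_zero, ← hb]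
    noncomm_ring
  · have := (hA.isMaximalClosedLeftIdeal_iff.1 hM).1
    exact Ring.jacobson_le_of_isMaximal M

end IsPseudocompactAlgebra

theorem Ring.mem_jacobson_iff_left {A : Type*} [Ring A] {x : A} :
    x ∈ Ring.jacobson A ↔ ∀ y : A, ∃ b : A, b * (1 - y * x) = 1 := by
  rw [← Ideal.jacobson_bot, Ideal.mem_jacobson_iff]
  refine ⟨fun h y => ?_, fun h y => ?_⟩
  · obtain ⟨b, hb⟩ := h (-y)
    refine ⟨b, ?_⟩
    rw [Ideal.mem_bot, sub_eq_zero] at hb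
    refine Eq.trans ?_ hb
    noncomm_ring
  · obtain ⟨b, hb⟩ := h (-y)
    refine ⟨b, ?_⟩
    rw [Ideal.mem_bot, sub_eq_zero, ← hb]; noncomm_ring

/-- A set that fails to generate lies in a maximal left ideal, which also contains the radical.
Conversely, a maximal left ideal `M` missing `a` is itself a test set `X` violating the condition.
-/
theorem Ring.mem_jacobson_iff_isNonGenerator {A : Type*} [Ring A] {a : A} :
    a ∈ Ring.jacobson A ↔ IsNonGenerator a := by
  refine ⟨fun ha X hX => ?_, fun h => ?_⟩
  · by_contra hne
    obtain ⟨M, hM, hle⟩ := Ideal.exists_le_maximal _ hne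
    refine hM.ne_top (eq_top_iff.2 (hX ▸ Ideal.span_le.2 (Set.union_subset
      (Ideal.span_le.1 hle) (Set.singleton_subset_iff.2 (Ring.jacobson_le_of_isMaximal M ha)))))
  · rw [Ring.jacobson_eq_sInf_isMaximal]
    refine Submodule.mem_sInf.2 fun (M : Ideal A) (hM : M.IsMaximal) => ?_
    by_contra haM
    refine hM.ne_top ?_
    rw [← Ideal.span_eq M]
    refine h M (hM.1.2 _ (lt_of_le_of_ne (fun x hx => Ideal.subset_span (Or.inl hx)) fun e => haM ?_))
    rw [e]
    exact Ideal.subset_span (Or.inr rfl)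

namespace IsPseudocompactAlgebra

variable {k : Type u} {A : Type v} [Field k] [Ring A] [Algebra k A]
    [UniformSpace A] [IsUniformAddGroup A] [IsTopologicalRing A]

theorem isUnit_one_sub (hA : IsPseudocompactAlgebra k A) {x : A} (hx : x ∈ Ring.jacobson A) :
    IsUnit (1 - x) :=
  hA.isUnit_of_forall_left fun I _ => by
    obtain ⟨b, hb⟩ := Ring.mem_jacobson_iff_left.1 hx 1
    rw [one_mul] at hb
    exact ⟨b, by simp [hb]⟩

theorem mem_jacobson_iff_isUnit (hA : IsPseudocompactAlgebra k A) {x : A} :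
    x ∈ Ring.jacobson A ↔ ∀ y z : A, IsUnit (1 - y * x * z) := by
  refine ⟨fun h y z => hA.isUnit_one_sub (Ideal.mul_mem_right _ _ (Ideal.mul_mem_left _ _ h)),
    fun h => Ring.mem_jacobson_iff_left.2 fun y => ?_⟩
  simpa using (h y 1).exists_left_inv

theorem mem_jacobson_iff_right (hA : IsPseudocompactAlgebra k A) {x : A} :
    x ∈ Ring.jacobson A ↔ ∀ M : Submodule Aᵐᵒᵖ A, IsMaximalClosedRightIdeal M → x ∈ M := by
  have unit_mem : ∀ {M : Submodule Aᵐᵒᵖ A} {u : A}, IsUnit u → u ∈ M → M = ⊤ := by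
    rintro M _ ⟨u, rfl⟩ hu
    refine Submodule.eq_top_iff'.2 fun a => ?_
    simpa using M.smul_mem (MulOpposite.op (↑u⁻¹ * a)) hu
  constructor
  · intro hx M hM
    have hco := (hA.isMaximalClosedRightIdeal_iff.1 hM).1
    by_contra hxM
    have hlt : M < M ⊔ Submodule.span Aᵐᵒᵖ {x} := lt_of_le_of_ne le_sup_left fun h =>
      hxM (h ▸ Submodule.mem_sup_right (Submodule.mem_span_singleton_self x))
    obtain ⟨m, hm, y, hy, e⟩ := Submodule.mem_sup.1
      (hco.2 _ hlt ▸ Submodule.mem_top : (1 : A) ∈ M ⊔ Submodule.span Aᵐᵒᵖ {x})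
    obtain ⟨a, rfl⟩ := Submodule.mem_span_singleton.1 hy
    -- From `1 = m + x * a` with `m ∈ M`, the element `m = 1 - x * a` is a unit in `M`.
    refine hco.1 (unit_mem (hA.isUnit_one_sub (Ideal.mul_mem_right a.unop _ hx)) ?_)
    rw [← e]
    simpa using hm
  · intro h
    refine Ring.mem_jacobson_iff_left.2 fun z => IsUnit.exists_left_inv ?_
    -- Right ideals control `1 - x * z`, whereas the radical asks about `1 - z * x`.
    refine IsUnit.one_sub_mul_comm (hA.isUnit_of_forall_right fun I hI => ?_)
    have : Module.Finite Aᵐᵒᵖ A := ⟨⟨{1}, by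
      rw [Finset.coe_singleton]
      exact unit_mem isUnit_one (Submodule.mem_span_singleton_self _)⟩⟩
    rcases eq_top_or_exists_le_coatom
      (Submodule.span Aᵐᵒᵖ {1 - x * z} ⊔ I.toRightIdeal hI.2.1) with ht | ⟨M, hM, hle⟩
    · obtain ⟨m, hm, y, hy, e⟩ := Submodule.mem_sup.1 (ht ▸ Submodule.mem_top : (1 : A) ∈ _)
      obtain ⟨b, rfl⟩ := Submodule.mem_span_singleton.1 hm
      refine ⟨b.unop, ?_⟩
      have hy' : y ∈ I := hy
      have : (1 - x * z) * b.unop - 1 = -y := by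
        have e' : (1 - x * z) * b.unop + y = 1 := e
        rw [← add_sub_cancel_right ((1 - x * z) * b.unop) y, e']; abel
      exact this ▸ I.neg_mem hy'
    · exfalso
      have hxM := h M (hA.isMaximalClosedRightIdeal_iff.2 ⟨hM, I, hI, le_sup_right.trans hle⟩)
      have h1 : 1 - x * z ∈ M :=
        hle (Submodule.mem_sup_left (Submodule.mem_span_singleton_self _))
      refine hM.1 (unit_mem isUnit_one ((M.sub_mem_iff_left ?_).1 h1))
      simpa using M.smul_mem (MulOpposite.op z) hxM

/-- The abstract argument works once a basic ideal is added to the proper closed ideal generated by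
`X`: the maximal ideal found above it is then closed. -/
theorem mem_jacobson_iff_isTopologicalNonGenerator (hA : IsPseudocompactAlgebra k A) {a : A} :
    a ∈ Ring.jacobson A ↔ IsTopologicalNonGenerator a := by
  refine ⟨fun ha X hX => ?_, fun h => ?_⟩
  · by_contra hne
    obtain ⟨I, hI, hs⟩ := Submodule.exists_sup_ne_top_of_isClosed hA.basis
      (P := (Ideal.span X).closure) isClosed_closure hne
    obtain ⟨M, hM, hle⟩ := Ideal.exists_le_maximal _ hs
    have hcl : IsClosed (M : Set A) := (hA.isMaximalClosedLeftIdeal_iff.2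
      ⟨hM, I, hI, le_sup_right.trans hle⟩).prop.1
    refine hM.ne_top (eq_top_iff.2 (hX ▸ ?_))
    refine closure_minimal (Ideal.span_le.2 (Set.union_subset (fun x hx => hle ?_)
      (Set.singleton_subset_iff.2 (Ring.jacobson_le_of_isMaximal M ha)))) hcl
    exact Ideal.mem_sup_left (subset_closure (Ideal.subset_span hx))
  · rw [← hA.topologicalJacobsonRadical_eq]
    refine Submodule.mem_sInf.2 fun M (hM : IsMaximalClosedLeftIdeal M) => ?_
    by_contra haM
    refine hM.prop.2 ?_
    rw [← Ideal.closure_eq_of_isClosed M hM.prop.1, ← Ideal.span_eq M]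
    refine h M (eq_top_iff.2 ?_)
    have : Ideal.span (M ∪ {a}) = ⊤ := (hA.isMaximalClosedLeftIdeal_iff.1 hM).1.1.2 _
      (lt_of_le_of_ne (fun x hx => Ideal.subset_span (Or.inl hx)) fun e => haM (by
        rw [e]; exact Ideal.subset_span (Or.inr rfl)))
    rw [← this]
    exact subset_closure

end IsPseudocompactAlgebra

/-! ### Annihilators of simple modules -/

theorem Ideal.IsTwoSided.sup {A : Type*} [Ring A] {I J : Ideal A} (hI : I.IsTwoSided)
    (hJ : J.IsTwoSided) : (I ⊔ J).IsTwoSided :=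
  ⟨fun b h => by
    obtain ⟨x, hx, y, hy, rfl⟩ := Submodule.mem_sup.1 h
    rw [add_mul]
    exact Submodule.add_mem_sup (I.mul_mem_right b hx) (J.mul_mem_right b hy)⟩

/-- If the annihilator `P` of a simple module `S` over a ring has Artinian quotient, then it is
maximal among the proper two-sided ideals. -/
theorem Module.eq_top_of_annihilator_lt {A S : Type*} [Ring A] [AddCommGroup S] [Module A S]
    [IsSimpleModule A S] [IsArtinian A (A ⧸ Module.annihilator A S)] {Q : Ideal A}
    (hQ : Q.IsTwoSided) (h : Module.annihilator A S < Q) : Q = ⊤ := by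
  set P := Module.annihilator A S with hP
  -- `A ⧸ P` embeds in a power of `S`, so its radical vanishes; being Artinian, it is semisimple and
  -- `Q ⧸ P` has a complement `R`.
  have hss : IsSemisimpleModule A (A ⧸ P) := by
    rw [IsArtinian.isSemisimpleModule_iff_jacobson]
    let f : A →ₗ[A] (S → S) := LinearMap.pi fun s => LinearMap.toSpanSingleton A S s
    have hf : LinearMap.ker f = P := by
      ext a
      simp [f, hP, Module.mem_annihilator, funext_iff]
    exact Module.jacobson_eq_bot_of_injective (P.liftQ f hf.ge)
      (LinearMap.ker_eq_bot.1 (Submodule.ker_liftQ_eq_bot _ _ _ hf.le))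
      (Module.jacobson_pi_eq_bot _ _ fun _ => IsSimpleModule.jacobson_eq_bot A _)
  obtain ⟨R, hR⟩ := exists_isCompl (Submodule.map P.mkQ Q)
  have hQR : ∀ x ∈ Q, P.mkQ x ∈ R → x ∈ P := fun x hx hxR => by
    have : P.mkQ x ∈ Submodule.map P.mkQ Q ⊓ R := ⟨Submodule.mem_map_of_mem hx, hxR⟩
    rw [hR.inf_eq_bot, Submodule.mem_bot] at this
    exact (Submodule.Quotient.mk_eq_zero P).1 this
  obtain ⟨q, hq, hqP⟩ := SetLike.exists_of_lt h
  obtain ⟨t, ht⟩ : ∃ t : S, q • t ≠ 0 := by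
    by_contra! hall
    exact hqP (Module.mem_annihilator.2 hall)
  -- For `r` over `R`, one has `Q * r ⊆ P`. If `r • s ≠ 0`, simplicity gives `t = a • r • s`, and
  -- then `q • t = 0`, a contradiction. So `r` annihilates `S`.
  have hRP : R = ⊥ := by
    refine (Submodule.eq_bot_iff _).2 fun y hy => ?_
    obtain ⟨r, rfl⟩ := P.mkQ_surjective y
    rw [← LinearMap.mem_ker, Submodule.ker_mkQ, hP, Module.mem_annihilator]
    intro s
    by_contra hs
    obtain ⟨a, rfl⟩ := IsSimpleModule.toSpanSingleton_surjective A hs t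
    refine ht ?_
    have : q * a * r ∈ P := hQR _ (Q.mul_mem_right _ (Q.mul_mem_right _ hq)) (by
      rw [← smul_eq_mul, map_smul]; exact R.smul_mem _ hy)
    simpa [mul_smul] using Module.mem_annihilator.1 this s
  have htop := hR.sup_eq_top
  rw [hRP, sup_bot_eq] at htop
  rw [← Submodule.comap_map_eq_self (f := P.mkQ) (p := Q) (by simpa using h.le), htop]
  rfl

/-! ### Closed powers of an ideal -/

theorem closedPow_isClosed {A : Type v} [Ring A] [TopologicalSpace A] [IsTopologicalRing A]
    {K : Ideal A} (hK : IsClosed (K : Set A)) : ∀ n, IsClosed (closedPow K n : Set A)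
  | 0 => isClosed_univ
  | 1 => hK
  | _ + 2 => isClosed_closure

theorem closedPow_antitone {A : Type v} [Ring A] [TopologicalSpace A] [IsTopologicalRing A]
    {K : Ideal A} (hK : IsClosed (K : Set A)) : Antitone (closedPow K) := by
  refine antitone_nat_of_succ_le fun n => ?_
  induction n with
  | zero => exact le_top
  | succ n ih =>
    cases n with
    | zero => exact closure_minimal (Ideal.mul_le_right (I := K) (J := K)) hK
    | succ n => exact closure_mono (Ideal.mul_mono_left (K := K) ih)

theorem pow_mem_closedPow {A : Type v} [Ring A] [TopologicalSpace A] [IsTopologicalRing A]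
    {K : Ideal A} {x : A} (hx : x ∈ K) : ∀ n, x ^ n ∈ closedPow K n
  | 0 => Submodule.mem_top
  | 1 => by simpa [closedPow] using hx
  | n + 2 => subset_closure (pow_succ x (n + 1) ▸ Ideal.mul_mem_mul (pow_mem_closedPow hx (n + 1)) hx)

/-- Closures disappear modulo an open ideal: any left ideal containing `I` is open, hence closed. -/
theorem closedPow_le_sup {A : Type v} [Ring A] [TopologicalSpace A] [IsTopologicalRing A]
    {I : Ideal A} (hI : IsOpen (I : Set A)) (hI2 : I.IsTwoSided) (K : Ideal A) :
    ∀ n, closedPow K n ≤ K ^ n ⊔ I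
  | 0 => by simp [Submodule.pow_zero, Ideal.one_eq_top]
  | 1 => by simp [closedPow, Submodule.pow_one]
  | n + 2 => by
    refine closure_minimal ?_ (Submodule.isClosed_of_isOpen (Submodule.isOpen_of_ge hI le_sup_right))
    refine Ideal.mul_le.2 fun r hr s hs => ?_
    obtain ⟨a, ha, b, hb, rfl⟩ := Submodule.mem_sup.1 (closedPow_le_sup hI hI2 K (n + 1) hr)
    rw [add_mul, Submodule.pow_succ]
    exact Submodule.add_mem_sup (Ideal.mul_mem_mul ha hs) (I.mul_mem_right s hb)

theorem Ideal.pow_le_comap_pow {A B : Type*} [Ring A] [Ring B] (f : A →+* B) {K : Ideal A}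
    {L : Ideal B} (h : K ≤ L.comap f) (n : ℕ) : K ^ n ≤ (L ^ n).comap f := by
  induction n with
  | zero => simp [Submodule.pow_zero, Ideal.one_eq_top]
  | succ n ih =>
    rw [Submodule.pow_succ, Submodule.pow_succ]
    refine Ideal.mul_le.2 fun r hr s hs => ?_
    rw [Ideal.mem_comap, map_mul]
    exact Ideal.mul_mem_mul (ih hr) (h hs)

/-! ### Simple pseudocompact modules -/

/-- A simple pseudocompact module is simple as an abstract module. -/
theorem IsSimplePseudocompactModule.isSimpleModule {k : Type u} {A : Type v} [Field k] [Ring A]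
    [Algebra k A] [UniformSpace A] {S : Type v} [AddCommGroup S] [Module k S] [Module A S]
    [UniformSpace S] (hS : IsSimplePseudocompactModule k A S) : IsSimpleModule A S := by
  have := hS.uniformAddGroup
  have := hS.t2
  have := hS.nontrivial
  -- Since `0` is closed, some basic open submodule is proper. It is closed too, hence zero, so `S`
  -- is discrete and all its submodules are closed.
  obtain ⟨N, ⟨hN, -⟩, hne⟩ := Submodule.exists_sup_ne_top_of_isClosed hS.hasBasis
    (P := ⊥) (by simp) bot_ne_top
  rw [bot_sup_eq] at hne
  obtain rfl := (hS.eq_bot_or_eq_top N (Submodule.isClosed_of_isOpen hN)).resolve_right hne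
  rw [isSimpleModule_iff]
  exact ⟨fun P => hS.eq_bot_or_eq_top P
    (Submodule.isClosed_of_isOpen (Submodule.isOpen_of_ge hN bot_le))⟩

theorem IsSimplePseudocompactModule.jacobson_le_annihilator {k : Type u} {A : Type v} [Field k]
    [Ring A] [Algebra k A] [UniformSpace A] {S : Type v} [AddCommGroup S] [Module k S] [Module A S]
    [UniformSpace S] (hS : IsSimplePseudocompactModule k A S) :
    Ring.jacobson A ≤ Module.annihilator A S := by
  have := hS.isSimpleModule
  exact IsSemisimpleModule.jacobson_le_annihilator A S

/-! ### Two-sided maximal ideals and pronilpotency -/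

namespace IsPseudocompactAlgebra

variable {k : Type u} {A : Type v} [Field k] [Ring A] [Algebra k A]
    [UniformSpace A] [IsUniformAddGroup A] [IsTopologicalRing A]

theorem mem_jacobson_iff_twoSided (hA : IsPseudocompactAlgebra k A) {x : A} :
    x ∈ Ring.jacobson A ↔ ∀ M : Ideal A, IsMaximalClosedTwoSidedIdeal M → x ∈ M := by
  constructor
  · intro hx M hM
    obtain ⟨hM2, hMc, hMt⟩ := hM.prop
    obtain ⟨I, hI, hs⟩ := Submodule.exists_sup_ne_top_of_isClosed hA.basis hMc hMt
    have hop : ∀ J : Ideal A, I ≤ J → IsClosed (J : Set A) := fun J h =>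
      Submodule.isClosed_of_isOpen (Submodule.isOpen_of_ge hI.1 h)
    have hIM : I ≤ M := le_sup_right.trans
      (hM.le_of_ge ⟨hM2.sup hI.2.1, hop _ le_sup_right, hs⟩ le_sup_left)
    -- If the sum were everything, `1 = m + j` would make `m = 1 - j` a unit in `M`; so maximality
    -- absorbs the radical.
    refine hM.le_of_ge (y := M ⊔ Ring.jacobson A)
      ⟨hM2.sup inferInstance, hop _ (hIM.trans le_sup_left), fun ht => hMt ?_⟩ le_sup_left
      (Ideal.mem_sup_right hx)
    obtain ⟨m, hm, j, hj, e⟩ := Submodule.mem_sup.1 (ht ▸ Submodule.mem_top : (1 : A) ∈ _)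
    refine M.eq_top_of_isUnit_mem hm ?_
    rw [eq_sub_of_add_eq e]
    exact hA.isUnit_one_sub hj
  · intro h
    rw [← hA.topologicalJacobsonRadical_eq]
    refine Submodule.mem_sInf.2 fun N hN => ?_
    obtain ⟨hmax, I, hI, hIN⟩ := hA.isMaximalClosedLeftIdeal_iff.1 hN
    have hsimple : IsSimpleModule A (A ⧸ N) := isSimpleModule_iff_isCoatom.2 hmax.1
    have hIP : I ≤ Module.annihilator A (A ⧸ N) := fun i hi =>
      Module.mem_annihilator.2 fun s => by
        obtain ⟨a, rfl⟩ := N.mkQ_surjective s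
        rw [← map_smul, ← LinearMap.mem_ker, Submodule.ker_mkQ]
        have := hI.2.1
        exact hIN (I.mul_mem_right a hi)
    have hPN : Module.annihilator A (A ⧸ N) ≤ N := fun p hp => by
      have := Module.mem_annihilator.1 hp (N.mkQ 1)
      rw [← map_smul, ← LinearMap.mem_ker, Submodule.ker_mkQ] at this
      simpa using this
    have hart : IsArtinian A (A ⧸ Module.annihilator A (A ⧸ N)) := by
      have := hI.2.2
      have := isArtinian_quotient_of_finiteDimensional k I
      exact isArtinian_of_surjective _ (Submodule.factor hIP) (Submodule.factor_surjective hIP)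
    refine hPN (h _ ⟨⟨inferInstance, Submodule.isClosed_of_isOpen
      (Submodule.isOpen_of_ge hI.1 hIP), fun ht => hmax.ne_top (top_le_iff.1 (ht ▸ hPN))⟩,
      fun Q hQ hle => ?_⟩)
    exact (hle.lt_or_eq.resolve_left fun hlt =>
      hQ.2.2 (Module.eq_top_of_annihilator_lt hQ.1 hlt)).ge

theorem isClosed_jacobson (hA : IsPseudocompactAlgebra k A) :
    IsClosed (Ring.jacobson A : Set A) := by
  rw [← hA.topologicalJacobsonRadical_eq, topologicalJacobsonRadical, Submodule.coe_sInf]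
  exact isClosed_biInter fun M (hM : IsMaximalClosedLeftIdeal M) => hM.prop.1

/-- The radical maps into that of the Artinian ring `A ⧸ I`, which is nilpotent, so some power falls
into `I`. -/
theorem isPronilpotent_jacobson (hA : IsPseudocompactAlgebra k A) :
    IsPronilpotent (Ring.jacobson A) := by
  refine (Submodule.eq_bot_iff _).2 fun x hx => hA.eq_of_forall_sub_mem fun I hI => ?_
  have hop := hI.1
  have h2 := hI.2.1
  have hfin := hI.2.2
  have := isArtinianRing_quotient_of_finiteDimensional k I
  obtain ⟨n, hn⟩ := IsSemiprimaryRing.isNilpotent (R := A ⧸ I)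
  have hle := Ideal.pow_le_comap_pow (Ideal.Quotient.mk I)
    (Ring.le_comap_jacobson (Ideal.Quotient.mk I)) n
  rw [hn] at hle
  have hle : Ring.jacobson A ^ n ≤ I := fun y hy => Ideal.Quotient.eq_zero_iff_mem.1 (hle hy)
  rw [sub_zero]
  exact sup_le hle le_rfl (closedPow_le_sup hop h2 _ n (Submodule.mem_iInf _ |>.1 hx n))

/-- The images of the closed powers in `A ⧸ I` stabilise. An `x` in the stable power is congruent
modulo `I` to some `c m` in every power; linear compactness replaces the `c m` by a single element
of the intersection, which is `0`, so `x ∈ I`. -/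
theorem exists_closedPow_le (hA : IsPseudocompactAlgebra k A) {K : Ideal A}
    (hK : IsClosed (K : Set A)) (hnil : IsPronilpotent K) {I : Ideal A}
    (hI : IsCofiniteOpenIdeal k I) : ∃ n, closedPow K n ≤ I := by
  have := hI.2.2
  have := isArtinian_quotient_of_finiteDimensional k I
  obtain ⟨n, hn⟩ := IsArtinian.monotone_stabilizes (R := A) (M := A ⧸ I)
    ⟨fun n => OrderDual.toDual (Submodule.map I.mkQ (closedPow K n)),
      fun m n h => Submodule.map_mono (closedPow_antitone hK h)⟩
  refine ⟨n, fun x hx => ?_⟩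
  have hex : ∀ m, ∃ c ∈ closedPow K m, c - x ∈ I := fun m => by
    rcases le_total m n with h | h
    · exact ⟨x, closedPow_antitone hK h hx, by simp⟩
    · have : I.mkQ x ∈ Submodule.map I.mkQ (closedPow K m) := by
        rw [← show Submodule.map I.mkQ (closedPow K n) = Submodule.map I.mkQ (closedPow K m) from hn m h]
        exact Submodule.mem_map_of_mem hx
      obtain ⟨c, hc, e⟩ := this
      exact ⟨c, hc, (Submodule.Quotient.eq I).1 e⟩
  choose c hc hcx using hex
  obtain ⟨a, ha⟩ := hA.exists_forall_sub_mem (fun m => closedPow K m ⊓ I)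
    (fun m n h => inf_le_inf_right I (closedPow_antitone hK h))
    (fun m => (closedPow_isClosed hK m).inter (Submodule.isClosed_of_isOpen hI.1)) c
    (fun i j h => ⟨sub_mem (closedPow_antitone hK h (hc j)) (hc i), by
      simpa using sub_mem (hcx j) (hcx i)⟩)
  have ha0 : a ∈ ⨅ n, closedPow K n := (Submodule.mem_iInf _).2 fun m => by
    simpa using add_mem (ha m).1 (hc m)
  rw [hnil, Submodule.mem_bot] at ha0
  simpa [ha0] using neg_mem (add_mem (ha 0).2 (hcx 0))

theorem le_jacobson_of_isPronilpotent (hA : IsPseudocompactAlgebra k A) {K : Ideal A}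
    (hK : IsClosed (K : Set A)) (hnil : IsPronilpotent K) : K ≤ Ring.jacobson A := by
  intro x hx
  refine Ring.mem_jacobson_iff_left.2 fun y => (IsUnit.exists_left_inv ?_)
  refine hA.isUnit_of_forall_left fun I hI => ?_
  obtain ⟨n, hn⟩ := hA.exists_closedPow_le hK hnil hI
  -- The truncated geometric series inverts `1 - y * x` up to `(y * x) ^ n`, which lies in `I`.
  refine ⟨∑ i ∈ Finset.range n, (y * x) ^ i, ?_⟩
  rw [← neg_sub (y * x) 1, mul_neg, geom_sum_mul]
  simpa using hn (pow_mem_closedPow (K.mul_mem_left y hx) n)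

end IsPseudocompactAlgebra

/-! ### Independent families of maximal left ideals -/

section Independent

variable {A : Type v} [Ring A]

/-- A set `T` of left ideals is independent if no member contains a finite intersection of other
members. -/
def Ideal.IsMeetIndependent (T : Set (Ideal A)) : Prop :=
  ∀ M ∈ T, ∀ F : Finset (Ideal A), (F : Set (Ideal A)) ⊆ T → M ∉ F → ¬ F.inf id ≤ M

/-- Exchange property for maximal left ideals. -/
theorem Ideal.inf_le_of_inf_le {M N K : Ideal A} (hN : N.IsMaximal) (h : N ⊓ K ≤ M)
    (hKM : ¬ K ≤ M) : M ⊓ K ≤ N := by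
  rintro y ⟨hyM, hyK⟩
  by_contra hyN
  obtain ⟨z, hzK, hzM⟩ := SetLike.not_le_iff_exists.1 hKM
  have htop : N ⊔ Ideal.span {y} = ⊤ := hN.1.2 _ (lt_of_le_of_ne le_sup_left fun e =>
    hyN (by rw [e]; exact Ideal.mem_sup_right (Ideal.mem_span_singleton_self y)))
  -- Here `z = n + a * y` with `z, y ∈ K`, so `n ∈ N ⊓ K ≤ M`; with `y ∈ M` this puts `z` in `M`.
  obtain ⟨n, hn, w, hw, e⟩ := Submodule.mem_sup.1 (htop ▸ Submodule.mem_top : z ∈ _)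
  obtain ⟨a, rfl⟩ := Ideal.mem_span_singleton'.1 hw
  refine hzM ?_
  rw [← e]
  refine M.add_mem (h ⟨hn, ?_⟩) (M.mul_mem_left a hyM)
  rw [eq_sub_of_add_eq e]
  exact K.sub_mem hzK (K.mul_mem_left a hyK)

/-- Any set `𝓜` of maximal left ideals has an independent subset such that every member of `𝓜`
contains a finite intersection of members of the subset. -/
theorem Ideal.exists_isMeetIndependent (𝓜 : Set (Ideal A)) (h𝓜 : ∀ M ∈ 𝓜, M.IsMaximal) :
    ∃ T ⊆ 𝓜, IsMeetIndependent T ∧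
      ∀ N ∈ 𝓜, ∃ F : Finset (Ideal A), (F : Set (Ideal A)) ⊆ T ∧ F.inf id ≤ N := by
  classical
  -- Independence has finite character, so unions of chains stay independent.
  obtain ⟨T, hT⟩ := zorn_subset {T | T ⊆ 𝓜 ∧ IsMeetIndependent T} (by
    intro c hc hchain
    refine ⟨⋃₀ c, ⟨Set.sUnion_subset fun T hT => (hc hT).1, fun M hM F hF hMF hle => ?_⟩,
      fun T hT => Set.subset_sUnion_of_mem hT⟩
    have hsub : ((insert M F : Finset (Ideal A)) : Set (Ideal A)) ⊆ ⋃₀ c := by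
      rw [Finset.coe_insert]
      exact Set.insert_subset hM hF
    obtain ⟨T₀, hT₀, -⟩ := hM
    obtain ⟨T, hT, h⟩ := DirectedOn.exists_mem_subset_of_finite_of_subset_sUnion ⟨T₀, hT₀⟩
      hchain.directedOn (Finset.finite_toSet _) hsub
    rw [Finset.coe_insert, Set.insert_subset_iff] at h
    exact (hc hT).2 M h.1 F h.2 hMF hle)
  obtain ⟨hT𝓜, hind⟩ := hT.prop
  refine ⟨T, hT𝓜, hind, fun N hN => ?_⟩
  by_cases hNT : N ∈ T
  · exact ⟨{N}, by simpa using hNT, by simp⟩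
  have hnot : ¬ IsMeetIndependent (insert N T) := fun h =>
    hNT (hT.le_of_ge (y := insert N T) ⟨Set.insert_subset hN hT𝓜, h⟩ (Set.subset_insert N T)
      (Set.mem_insert N T))
  simp only [IsMeetIndependent, not_forall, not_not] at hnot
  obtain ⟨M, hM, F, hF, hMF, hle⟩ := hnot
  have herase : ((F.erase N : Finset (Ideal A)) : Set (Ideal A)) ⊆ T := fun x hx => by
    rw [Finset.mem_coe, Finset.mem_erase] at hx
    exact (hF hx.2).resolve_left hx.1
  -- A dependence created by adding `N` must involve `N`: on the small side it is solved for `N` by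
  -- exchange, on the large side it is already the desired inclusion.
  by_cases hNF : N ∈ F
  · have hMN : M ≠ N := fun e => hMF (e ▸ hNF)
    have hMT : M ∈ T := hM.resolve_left hMN
    refine ⟨insert M (F.erase N), ?_, ?_⟩
    · rw [Finset.coe_insert]
      exact Set.insert_subset hMT herase
    · rw [Finset.inf_insert]
      rw [← Finset.insert_erase hNF, Finset.inf_insert] at hle
      exact inf_le_of_inf_le (h𝓜 N hN) hle
        (hind M hMT _ herase fun h => hMF (Finset.mem_of_mem_erase h))
  · rw [Finset.erase_eq_of_notMem hNF] at herase
    obtain rfl | hMT := hM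
    · exact ⟨F, herase, hle⟩
    · exact absurd hle (hind M hMT F herase hMF)

/-- Finite approximation for an independent set of maximal left ideals. -/
theorem Ideal.IsMeetIndependent.exists_forall_sub_mem {T : Set (Ideal A)}
    (hT : IsMeetIndependent T) (hmax : ∀ M ∈ T, M.IsMaximal) (t : Ideal A → A)
    (F : Finset (Ideal A)) (hF : (F : Set (Ideal A)) ⊆ T) : ∃ a, ∀ M ∈ F, a - t M ∈ M := by
  classical
  induction F using Finset.induction_on with
  | empty => exact ⟨0, by simp⟩
  | insert M F hMF ih =>
    rw [Finset.coe_insert, Set.insert_subset_iff] at hF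
    obtain ⟨a, ha⟩ := ih hF.2
    -- Adding a multiple of `z` adjusts the residue modulo `M` without changing those modulo the
    -- members of `F`.
    obtain ⟨z, hz, hzM⟩ := SetLike.not_le_iff_exists.1 (hT M hF.1 F hF.2 hMF)
    have htop : M ⊔ Ideal.span {z} = ⊤ := (hmax M hF.1).1.2 _ (lt_of_le_of_ne le_sup_left fun e =>
      hzM (by rw [e]; exact Ideal.mem_sup_right (Ideal.mem_span_singleton_self z)))
    obtain ⟨m, hm, w, hw, e⟩ := Submodule.mem_sup.1 (htop ▸ Submodule.mem_top : t M - a ∈ _)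
    obtain ⟨b, rfl⟩ := Ideal.mem_span_singleton'.1 hw
    refine ⟨a + b * z, fun N hN => ?_⟩
    obtain rfl | hN := Finset.mem_insert.1 hN
    · have : a + b * z - t N = -m := by
        rw [eq_sub_of_add_eq e]; abel
      exact this ▸ N.neg_mem hm
    · have hzN : z ∈ N := Finset.inf_le (f := id) hN hz
      have := N.add_mem (ha N hN) (N.mul_mem_left b hzN)
      convert this using 1; abel

end Independent

/-! ### Discrete simple quotients -/

section DiscreteQuotient

variable {A : Type v} [Ring A]

/-- The quotient of `A` by a left ideal, with the discrete topology. -/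
def DiscreteQuotientModule (M : Ideal A) : Type v := A ⧸ M

namespace DiscreteQuotientModule

variable (M : Ideal A)

instance : AddCommGroup (DiscreteQuotientModule M) := inferInstanceAs (AddCommGroup (A ⧸ M))
instance : Module A (DiscreteQuotientModule M) := inferInstanceAs (Module A (A ⧸ M))
instance {k : Type u} [Field k] [Algebra k A] : Module k (DiscreteQuotientModule M) :=
  inferInstanceAs (Module k (A ⧸ M))
instance {k : Type u} [Field k] [Algebra k A] : IsScalarTower k A (DiscreteQuotientModule M) :=
  inferInstanceAs (IsScalarTower k A (A ⧸ M))
instance : UniformSpace (DiscreteQuotientModule M) := ⊥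
instance : DiscreteUniformity (DiscreteQuotientModule M) := ⟨rfl⟩

/-- The projection of `A` onto the discrete quotient. -/
def mk : A →ₗ[A] DiscreteQuotientModule M := M.mkQ

theorem mk_surjective : Function.Surjective (mk M) := M.mkQ_surjective

theorem mk_eq_zero {a : A} : mk M a = 0 ↔ a ∈ M := Submodule.Quotient.mk_eq_zero M

theorem ker_mk : LinearMap.ker (mk M) = M := M.ker_mkQ

variable {M}

theorem continuous_mk [TopologicalSpace A] [IsTopologicalRing A] (hM : IsOpen (M : Set A)) :
    Continuous (mk M) := by
  refine continuous_of_continuousAt_zero (mk M).toAddMonoidHom ?_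
  rw [ContinuousAt, nhds_discrete (DiscreteQuotientModule M), Filter.tendsto_pure]
  filter_upwards [hM.mem_nhds M.zero_mem] with a ha
  exact ((mk_eq_zero M).2 ha).trans (map_zero _).symm

theorem isSimplePseudocompactModule {k : Type u} [Field k] [Algebra k A] [UniformSpace A]
    [IsTopologicalRing A] (hM : M.IsMaximal) (hop : IsOpen (M : Set A))
    [FiniteDimensional k (A ⧸ M)] :
    IsSimplePseudocompactModule k A (DiscreteQuotientModule M) := by
  have hsimple : IsSimpleModule A (DiscreteQuotientModule M) := isSimpleModule_iff_isCoatom.2 hM.1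
  have hfin : FiniteDimensional k (DiscreteQuotientModule M) :=
    inferInstanceAs (FiniteDimensional k (A ⧸ M))
  have hbot : FiniteDimensional k
      (DiscreteQuotientModule M ⧸ (⊥ : Submodule A (DiscreteQuotientModule M))) :=
    Module.Finite.quotient k _
  have hbasis : (𝓝 (0 : DiscreteQuotientModule M)).HasBasis
      (fun N : Submodule A (DiscreteQuotientModule M) =>
        IsOpen (N : Set (DiscreteQuotientModule M)) ∧
          FiniteDimensional k (DiscreteQuotientModule M ⧸ N)) (fun N => N) := by
    rw [nhds_discrete]
    refine ⟨fun s => ⟨fun hs => ⟨⊥, ⟨isOpen_discrete _, hbot⟩, fun x hx => ?_⟩, fun h => ?_⟩⟩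
    · rw [(Submodule.mem_bot A).1 hx]
      exact Filter.mem_pure.1 hs
    · obtain ⟨N, -, h⟩ := h
      exact Filter.mem_pure.2 (h N.zero_mem)
  exact
  { tower := inferInstance
    uniformAddGroup := inferInstance
    continuousSMul := ⟨by
      refine continuous_prod_of_discrete_right.2 fun s => ?_
      obtain ⟨b, rfl⟩ := mk_surjective M s
      simp_rw [← map_smul]
      exact (continuous_mk hop).comp (continuous_id.mul continuous_const)⟩
    t2 := inferInstance
    complete := inferInstance
    hasBasis := hbasis
    nontrivial := IsSimpleModule.nontrivial A _
    eq_bot_or_eq_top := fun N _ => eq_bot_or_eq_top N }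

end DiscreteQuotientModule

end DiscreteQuotient

/-! ### Annihilators and the product decomposition -/

namespace IsPseudocompactAlgebra

variable {k : Type u} {A : Type v} [Field k] [Ring A] [Algebra k A]
    [UniformSpace A] [IsUniformAddGroup A] [IsTopologicalRing A]

theorem isSimplePseudocompactModule (hA : IsPseudocompactAlgebra k A) {M : Ideal A}
    (hM : IsMaximalClosedLeftIdeal M) :
    IsSimplePseudocompactModule k A (DiscreteQuotientModule M) := by
  obtain ⟨hmax, I, hI, hIM⟩ := hA.isMaximalClosedLeftIdeal_iff.1 hM
  have := hI.2.2
  have : FiniteDimensional k (A ⧸ M) := Module.Finite.of_surjective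
    ((Submodule.factor hIM).restrictScalars k) (Submodule.factor_surjective hIM)
  exact DiscreteQuotientModule.isSimplePseudocompactModule hmax (Submodule.isOpen_of_ge hI.1 hIM)

theorem mem_jacobson_iff_annihilator (hA : IsPseudocompactAlgebra k A) {x : A} :
    x ∈ Ring.jacobson A ↔
      ∀ (S : Type v) [AddCommGroup S] [Module k S] [Module A S] [UniformSpace S],
        IsSimplePseudocompactModule k A S → x ∈ Module.annihilator A S := by
  refine ⟨fun hx S _ _ _ _ hS => hS.jacobson_le_annihilator hx, fun h => ?_⟩
  rw [← hA.topologicalJacobsonRadical_eq]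
  refine Submodule.mem_sInf.2 fun M hM => ?_
  have := Module.mem_annihilator.1 (h _ (hA.isSimplePseudocompactModule hM))
    (DiscreteQuotientModule.mk M 1)
  rwa [← map_smul, DiscreteQuotientModule.mk_eq_zero, smul_eq_mul, mul_one] at this

/-- An open ideal containing the intersection of a family of open left ideals, up to a summand,
already contains a finite intersection. -/
theorem exists_finset_inf_le_sup (hA : IsPseudocompactAlgebra k A) {ι : Type*} (N : ι → Ideal A)
    (hN : ∀ i, IsClosed (N i : Set A)) {I : Ideal A} (hI : IsCofiniteOpenIdeal k I) :
    ∃ F : Finset ι, F.inf N ≤ (⨅ i, N i) ⊔ I := by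
  classical
  have := hI.2.2
  have := isArtinian_quotient_of_finiteDimensional k I
  -- For `F` with minimal image in `A ⧸ I`, each `x` in its intersection can be matched modulo `I`
  -- inside every finite intersection; linear compactness then matches it inside the full one.
  obtain ⟨_, ⟨F, rfl⟩, hmin⟩ := wellFounded_lt.has_min
    (Set.range fun F : Finset ι => Submodule.map I.mkQ (F.inf N)) (Set.range_nonempty _)
  refine ⟨F, fun x hx => ?_⟩
  have hex : ∀ G : Finset ι, ∃ c ∈ G.inf N, c - x ∈ I := fun G => by
    have hle : (F ∪ G).inf N ≤ F.inf N := Finset.inf_mono Finset.subset_union_left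
    have heq := (Submodule.map_mono (f := I.mkQ) hle).eq_of_not_lt (hmin _ ⟨F ∪ G, rfl⟩)
    have : I.mkQ x ∈ Submodule.map I.mkQ ((F ∪ G).inf N) := by
      rw [heq]
      exact Submodule.mem_map_of_mem hx
    obtain ⟨c, hc, e⟩ := this
    exact ⟨c, Finset.inf_mono (f := N) Finset.subset_union_right hc, (Submodule.Quotient.eq I).1 e⟩
  choose c hc hcx using hex
  have hcl : ∀ G : Finset ι, IsClosed ((G.inf N : Ideal A) : Set A) := fun G => by
    rw [Finset.inf_eq_iInf]
    simp only [Submodule.coe_iInf]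
    exact isClosed_biInter fun i _ => hN i
  obtain ⟨a, ha⟩ := hA.exists_forall_sub_mem (fun G : Finset ι => G.inf N ⊓ I)
    (fun G H h => inf_le_inf_right I (Finset.inf_mono h))
    (fun G => (hcl G).inter (Submodule.isClosed_of_isOpen hI.1)) c
    (fun G H h => ⟨sub_mem (Finset.inf_mono (f := N) h (hc H)) (hc G), by
      simpa using sub_mem (hcx H) (hcx G)⟩)
  refine Submodule.mem_sup.2 ⟨a, (Submodule.mem_iInf _).2 fun i => ?_, x - a, ?_, by abel⟩
  · have := add_mem (ha {i}).1 (hc {i})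
    simpa using this
  · have := neg_mem (add_mem (ha ∅).2 (hcx ∅))
    simpa using this

/-- The family of all maximal closed left ideals may be too redundant for a surjection onto the
product. An independent subfamily `T` in which each of them contains a finite intersection has the
same total intersection, and solves all simultaneous congruences. -/
theorem quotientIsProductOfSimples_jacobson (hA : IsPseudocompactAlgebra k A) :
    QuotientIsProductOfSimples k (Ring.jacobson A) := by
  classical
  obtain ⟨T, hT, hind, hcof⟩ := Ideal.exists_isMeetIndependent
    {M : Ideal A | IsMaximalClosedLeftIdeal M}
    fun M hM => (hA.isMaximalClosedLeftIdeal_iff.1 hM).1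
  have hmax : ∀ M ∈ T, M.IsMaximal := fun M hM => (hA.isMaximalClosedLeftIdeal_iff.1 (hT hM)).1
  have hopen : ∀ M ∈ T, IsOpen (M : Set A) := fun M hM => by
    obtain ⟨-, I, hI, hIM⟩ := hA.isMaximalClosedLeftIdeal_iff.1 (hT hM)
    exact Submodule.isOpen_of_ge hI.1 hIM
  let φ : A →ₗ[A] (∀ M : T, DiscreteQuotientModule M.1) :=
    LinearMap.pi fun M => DiscreteQuotientModule.mk M.1
  have hinf : Ring.jacobson A = ⨅ M : T, M.1 := by
    rw [← hA.topologicalJacobsonRadical_eq]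
    refine le_antisymm (le_iInf fun M => sInf_le (hT M.2)) (le_sInf fun N hN => ?_)
    obtain ⟨F, hF, hle⟩ := hcof N hN
    exact (Finset.le_inf fun M hM => iInf_le (fun M : T => M.1) ⟨M, hF hM⟩).trans hle
  have hker : LinearMap.ker φ = Ring.jacobson A := by
    rw [hinf, LinearMap.ker_pi]
    simp only [DiscreteQuotientModule.ker_mk]
  have hcont : Continuous φ :=
    continuous_pi fun M => DiscreteQuotientModule.continuous_mk (hopen M.1 M.2)
  have hsurj : Function.Surjective φ := by
    intro t
    choose t' ht' using fun M : T => DiscreteQuotientModule.mk_surjective M.1 (t M)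
    choose c hc using fun F : Finset T => hind.exists_forall_sub_mem hmax
      (fun M => if h : M ∈ T then t' ⟨M, h⟩ else 0) (F.map (Function.Embedding.subtype _))
      (by intro M hM; simp at hM; exact hM.1)
    have hc' : ∀ (F : Finset T) (M : T), M ∈ F → c F - t' M ∈ M.1 := fun F M hM => by
      simpa using hc F M.1 (Finset.mem_map_of_mem _ hM)
    obtain ⟨a, ha⟩ := hA.exists_forall_sub_mem (fun F : Finset T => ⨅ M ∈ F, M.1)
      (fun F G h => biInf_mono h)
      (fun F => by
        simp only [Submodule.coe_iInf]
        exact isClosed_biInter fun M _ => Submodule.isClosed_of_isOpen (hopen M.1 M.2)) c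
      (fun F G h => by
        simp only [Submodule.mem_iInf]
        intro M hM
        simpa using sub_mem (hc' G M (h hM)) (hc' F M hM))
    refine ⟨a, funext fun M => ?_⟩
    rw [← ht' M]
    change DiscreteQuotientModule.mk M.1 a = _
    rw [← sub_eq_zero, ← map_sub, DiscreteQuotientModule.mk_eq_zero]
    have h1 := ha {M}
    simp only [Submodule.mem_iInf] at h1
    simpa using add_mem (h1 M (Finset.mem_singleton_self M)) (hc' {M} M (Finset.mem_singleton_self M))
  -- A point vanishing on the coordinates in `F` lifts into `Ring.jacobson A ⊔ I`, and the radical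
  -- is the kernel, so the point already lies in `φ '' I`.
  have hφopen : IsOpenMap φ := by
    refine IsTopologicalAddGroup.isOpenMap_iff_nhds_zero.2 fun s hs => ?_
    obtain ⟨I, hI, hIs⟩ := hA.basis.mem_iff.1 (Filter.mem_map.1 hs)
    obtain ⟨F, hF⟩ := hA.exists_finset_inf_le_sup (fun M : T => M.1)
      (fun M => Submodule.isClosed_of_isOpen (hopen M.1 M.2)) hI
    rw [← hinf] at hF
    have hU : (F : Set T).pi (fun M => ({0} : Set (DiscreteQuotientModule M.1))) ∈ 𝓝 0 :=
      set_pi_mem_nhds F.finite_toSet fun M _ => (isOpen_discrete _).mem_nhds rfl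
    refine Filter.mem_of_superset hU fun t ht => ?_
    obtain ⟨a, rfl⟩ := hsurj t
    have haF : a ∈ F.inf fun M : T => M.1 := by
      simp only [Submodule.mem_finsetInf]
      exact fun M hM => (DiscreteQuotientModule.mk_eq_zero M.1).1 (ht M hM)
    obtain ⟨v, hv, i, hi, rfl⟩ := Submodule.mem_sup.1 (hF haF)
    rw [map_add, LinearMap.mem_ker.1 (hker.ge hv), zero_add]
    exact hIs hi
  let ψ : (A ⧸ Ring.jacobson A) →ₗ[A] (∀ M : T, DiscreteQuotientModule M.1) :=
    (Ring.jacobson A).liftQ φ hker.ge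
  have hψ : Function.Bijective ψ :=
    ⟨LinearMap.ker_eq_bot.1 (Submodule.ker_liftQ_eq_bot _ _ _ hker.le), fun t => by
      obtain ⟨a, rfl⟩ := hsurj t
      exact ⟨(Ring.jacobson A).mkQ a, rfl⟩⟩
  have hψcont : Continuous ψ := continuous_quot_lift _ hcont
  have hψopen : IsOpenMap ψ := fun U hU => by
    have : ψ '' U = φ '' ((Ring.jacobson A).mkQ ⁻¹' U) := by
      rw [← Set.image_preimage_eq U (Ring.jacobson A).mkQ_surjective, Set.image_image,
        Set.image_preimage_eq U (Ring.jacobson A).mkQ_surjective]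
      rfl
    rw [this]
    exact hφopen _ (hU.preimage continuous_quot_mk)
  let e := LinearEquiv.ofBijective ψ hψ
  exact ⟨T, fun M => DiscreteQuotientModule M.1, inferInstance, inferInstance, inferInstance,
    inferInstance, fun M => hA.isSimplePseudocompactModule (hT M.2),
    ⟨{ e with
      continuous_toFun := hψcont
      continuous_invFun := e.toEquiv.continuous_symm_iff.2 hψopen }⟩⟩

end IsPseudocompactAlgebra

/-! ### Minimality and the main theorem -/

/-- The radical kills every simple factor, hence the class of `1` in `A ⧸ V`. -/
theorem QuotientIsProductOfSimples.jacobson_le {k : Type u} {A : Type v} [Field k] [Ring A]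
    [Algebra k A] [UniformSpace A] {V : Submodule A A}
    (hV : QuotientIsProductOfSimples k V) : Ring.jacobson A ≤ V := by
  obtain ⟨ι, S, _, _, _, _, hS, ⟨e⟩⟩ := hV
  intro x hx
  have h : e (x • V.mkQ 1) = 0 := by
    rw [map_smul]
    exact funext fun i => Module.mem_annihilator.1 ((hS i).jacobson_le_annihilator hx) _
  have h0 : V.mkQ x = 0 := by
    rw [← e.map_eq_zero_iff, ← h, ← map_smul, smul_eq_mul, mul_one]
  exact (Submodule.Quotient.mk_eq_zero V).1 h0

theorem mainTheorem5 {k : Type u} {A : Type v} [Field k] [Ring A] [Algebra k A]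
    [UniformSpace A] [IsUniformAddGroup A] [IsTopologicalRing A]
    (hA : IsPseudocompactAlgebra k A) :
    -- the intersection of the maximal closed right ideals
    (topologicalJacobsonRadical A : Set A) =
      ⋂ M ∈ {M : Submodule Aᵐᵒᵖ A | IsMaximalClosedRightIdeal M}, (M : Set A) ∧
    -- the intersection of the maximal closed two-sided ideals
    (topologicalJacobsonRadical A : Set A) =
      ⋂ M ∈ {M : Ideal A | IsMaximalClosedTwoSidedIdeal M}, (M : Set A) ∧
    -- the intersection of all maximal left ideals
    (topologicalJacobsonRadical A : Set A) =
      ⋂ M ∈ {M : Ideal A | M.IsMaximal}, (M : Set A) ∧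
    -- the quasi-invertibility sets
    (topologicalJacobsonRadical A : Set A) = {x | ∀ y : A, ∃ b : A, b * (1 - y * x) = 1} ∧
    (topologicalJacobsonRadical A : Set A) = {x | ∀ y z : A, IsUnit (1 - y * x * z)} ∧
    -- the non-generators and the topological non-generators
    (topologicalJacobsonRadical A : Set A) = {a | IsNonGenerator a} ∧
    (topologicalJacobsonRadical A : Set A) = {a | IsTopologicalNonGenerator a} ∧
    -- the intersection of the annihilators of the simple pseudocompact left modules
    (topologicalJacobsonRadical A : Set A) =
      {x | ∀ (S : Type v) [AddCommGroup S] [Module k S] [Module A S] [UniformSpace S],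
        IsSimplePseudocompactModule k A S → x ∈ Module.annihilator A S} ∧
    -- the smallest closed submodule with quotient a product of simple modules
    IsLeast {V : Submodule A A | IsClosed (V : Set A) ∧ QuotientIsProductOfSimples k V}
      (topologicalJacobsonRadical A) ∧
    -- the largest closed pronilpotent two-sided ideal
    IsGreatest {I : Ideal A | I.IsTwoSided ∧ IsClosed (I : Set A) ∧ IsPronilpotent I}
      (topologicalJacobsonRadical A) := by
  rw [hA.topologicalJacobsonRadical_eq]
  refine ⟨Set.ext fun x => ?_, Set.ext fun x => ?_, ?_, Set.ext fun x => ?_, Set.ext fun x => ?_,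
    Set.ext fun x => ?_, Set.ext fun x => ?_, Set.ext fun x => hA.mem_jacobson_iff_annihilator,
    ⟨⟨hA.isClosed_jacobson, hA.quotientIsProductOfSimples_jacobson⟩, fun V hV =>
      hV.2.jacobson_le⟩,
    ⟨⟨inferInstance, hA.isClosed_jacobson, hA.isPronilpotent_jacobson⟩, fun K hK =>
      hA.le_jacobson_of_isPronilpotent hK.2.1 hK.2.2⟩⟩
  · simpa using hA.mem_jacobson_iff_right
  · simpa using hA.mem_jacobson_iff_twoSided
  · rw [Ring.jacobson_eq_sInf_isMaximal, Submodule.coe_sInf]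
  · exact Ring.mem_jacobson_iff_left
  · exact hA.mem_jacobson_iff_isUnit
  · exact Ring.mem_jacobson_iff_isNonGenerator
  · exact hA.mem_jacobson_iff_isTopologicalNonGenerator
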